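/- Let $q=p^f$ be a power of a prime $p$ (with $f\ge 1$), let $\epsilon\in\{1,-1\}$ and let $n\geq 1$. Write $\mathrm{GL}_n^{\epsilon}(q)$ for the general linear group $\mathrm{GL}_n(q)$ over $\mathbb{F}_q$ if $\epsilon=1$, and for the general unitary group $\mathrm{GU}_n(q)=\{A\in \mathrm{GL}_n(\mathbb{F}_{q^2}) : (A^{(q)})^{T}A=I_n\}$ if $\epsilon=-1$, where $A^{(q)}$ is obtained from $A$ by raising every entry to the $q$-th power. For a nonzero integer $m$ let $m_3$ denote the largest power of $3$ dividing $m$. Let $P$ be a Sylow $3$-subgroup of $\mathrm{GL}_n^{\epsilon}(q)$, with commutator subgroup $P'$. If $3\mid (q-\epsilon)$, then $[P:P']=9$ if and only if one of the following holds: (1) $n=1$ and $(q-\epsilon)_3=9$; or (2) $n\in\{2,3\}$ and $(q-\epsilon)_3=3$. If $3\mid (q+\epsilon)$, then $[P:P']=9$ if and only if one of the following holds: (1) $n\in\{2,3\}$ and $(q+\epsilon)_3=9$; or (2) $4\leq n\leq 7$ and $(q+\epsilon)_3=3$. -/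

import Mathlib

open scoped Matrix

/-- The subgroup of `GL_n(R)` preserving the standard `σ`-sesquilinear form
`⟨x, y⟩ = ∑ i, σ (x i) * y i`, that is, `{A | σ(A)ᵀ A = 1}`, where `σ` is applied entrywise. -/
def isometrySubgroup (n : ℕ) {R : Type*} [CommRing R] (σ : R →+* R) :
    Subgroup (GL (Fin n) R) where
  carrier := {A | ((A : Matrix (Fin n) (Fin n) R).map σ)ᵀ * (A : Matrix (Fin n) (Fin n) R) = 1}
  one_mem' := by
    simp
  mul_mem' := by
    intro A B hA hB
    simp only [Set.mem_ofPred_eq] at hA hB ⊢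
    rw [Units.val_mul, Matrix.map_mul, Matrix.transpose_mul, Matrix.mul_assoc,
      ← Matrix.mul_assoc _ (A : Matrix (Fin n) (Fin n) R), hA, Matrix.one_mul, hB]
  inv_mem' := by
    intro A hA
    simp only [Set.mem_ofPred_eq] at hA ⊢
    have h1 : ((A : Matrix (Fin n) (Fin n) R).map σ)ᵀ = (A⁻¹ : GL (Fin n) R).val := by
      calc _ = ((A : Matrix (Fin n) (Fin n) R).map σ)ᵀ * (A.val * (A⁻¹ : GL (Fin n) R).val) := by
            rw [Units.mul_inv, Matrix.mul_one]
        _ = _ := by rw [← Matrix.mul_assoc, hA, Matrix.one_mul]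
    calc _ = ((A⁻¹ : GL (Fin n) R).val.map σ)ᵀ * ((A : Matrix (Fin n) (Fin n) R).map σ)ᵀ := by
          rw [h1]
      _ = 1 := by
          rw [← Matrix.transpose_mul, ← Matrix.map_mul, Units.mul_inv]
          simp

/-- The field over which the matrices in `GL_n^ε(q)`, `q = p ^ f`, are written:
`𝔽_q` for `ε = 1` and `𝔽_{q²}` for `ε = -1`. -/
abbrev GLEpsField (p f : ℕ) [Fact p.Prime] (ε : ℤˣ) : Type :=
  GaloisField p (if ε = 1 then f else 2 * f)

/-- The group `GL_n^ε(q)` for `q = p ^ f`: the full general linear group `GL_n(q)` over `𝔽_q` if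
`ε = 1`, and the general unitary group `GU_n(q) = {A ∈ GL_n(q²) | σ(A)ᵀ A = 1}`, with
`σ : x ↦ x ^ q`, if `ε = -1`. -/
noncomputable def GLEps (n p f : ℕ) [Fact p.Prime] (ε : ℤˣ) : Subgroup (GL (Fin n) (GLEpsField p f ε)) :=
  if ε = 1 then ⊤ else isometrySubgroup n (iterateFrobenius (GLEpsField p f ε) p f)

/-- The `3`-part `m_3` of a nonzero integer `m`: the largest power of `3` dividing `m`. -/
def threePart (m : ℤ) : ℕ := 3 ^ padicValInt 3 m

/-!
Write `n = b * m + r`, where `b = 1` and `r = 0` if `3 ∣ q - ε`, and `b = 2`, `r < 2` if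
`3 ∣ q + ε`; let `3 ^ a` be the `3`-part of `q - ε` or `q + ε` respectively. A Sylow `3`-subgroup of
`GL_n^ε(q)` is isomorphic to the wreath product `C ≀ S`, where `C` is cyclic of order `3 ^ a` and
`S` is a Sylow `3`-subgroup of the symmetric group on `m` points.

* The wreath product embeds into `GL_n^ε(q)` by block monomial matrices (`blockMonomial`), once `C`
  is embedded into `GL_b^ε(q)`. For `b = 1` it consists of roots of unity. For `b = 2` it is taken
  inside the multiplicative group of the quadratic extension of `𝔽_q` if `ε = 1`
  (`exists_injective_rootsOfUnity_matrix_two`), and inside the split torus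
  `{diag(ζ, ζ⁻¹) | ζ ∈ 𝔽_q}` with respect to a hyperbolic basis if `ε = -1`
  (`exists_injective_rootsOfUnity_isometry_two`).
* It is a Sylow subgroup by comparison of orders. Up to powers of `q`, the order of `GL_n^ε(q)` is
  the product of the `q ^ d - ε ^ d` for `d ≤ n`, whose `3`-part is given by lifting the exponent
  (`padicValInt_prod_of_three_dvd_sub`, `padicValInt_prod_of_three_dvd_add`). The order of the
  unitary group is obtained by counting orthonormal families (`card_isometrySubgroup`).
* The abelianization of `C ≀ S` is `C ^ (orbits of S) × S / S'` (`commutator_permWreath_index`), so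
  its order is `3 ^ (a * o + s)` with `o` the number of orbits and `3 ^ s = |S / S'|`. This is `9`
  exactly if `a * o + s = 2` (`pow_mul_commutator_index_eq_nine_iff`). Nothing about the structure
  of `S` is needed here: `s = 0` means that `S` is trivial, that is `m ≤ 2` and `o = m`; otherwise
  `o = s = 1`, so the nilpotent group `S` has a cyclic abelianization, hence is itself abelian of
  order `3`, and a transitive group of order `3` acts on `m = 3` points.
-/

/-! ### Abelianizations of wreath products -/

theorem commutator_index_congr {G H : Type*} [Group G] [Group H] (e : G ≃* H) :
    (commutator G).index = (commutator H).index := by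
  simp only [Subgroup.index]
  exact Nat.card_congr e.abelianizationCongr.toEquiv

section Wreath

variable (A S Ω : Type*) [CommGroup A] [Group S] [MulAction S Ω]

/-- The permutational wreath product of `A` by `S` acting on `Ω`, that is, the semidirect product
`A ^ Ω ⋊ S` in which `S` permutes the coordinates. -/
abbrev PermWreath := (Ω → A) ⋊[mulAutArrow (G := S) (A := Ω) (M := A)] S

variable {A S Ω}

theorem mulAutArrow_apply_eq (s : S) (f : Ω → A) (i : Ω) :
    mulAutArrow (G := S) (A := Ω) (M := A) s f i = f (s⁻¹ • i) := rfl

/-- In the abelianization, the coordinate subgroups belonging to one orbit are identified. -/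
theorem of_inl_mulSingle_smul [DecidableEq Ω] (s : S) (i : Ω) (x : A) :
    Abelianization.of (SemidirectProduct.inl (Pi.mulSingle (s • i) x) : PermWreath A S Ω) =
      Abelianization.of (SemidirectProduct.inl (Pi.mulSingle i x)) := by
  have h : (Pi.mulSingle (s • i) x : Ω → A) = mulAutArrow (G := S) s (Pi.mulSingle i x) := by
    funext j
    rw [mulAutArrow_apply_eq]
    simp only [Pi.mulSingle_apply, inv_smul_eq_iff]
  rw [h, SemidirectProduct.inl_aut, map_mul, map_mul, mul_right_comm, ← map_mul, ← map_mul]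
  simp

variable [Fintype Ω]

open scoped Classical in
/-- The homomorphism from the wreath product to `A ^ (orbits of S) × S / S'` that multiplies the
coordinates over each orbit. It is the abelianization map, see `ker_orbitProd`. -/
noncomputable def orbitProd : PermWreath A S Ω →*
    (MulAction.orbitRel.Quotient S Ω → A) × Abelianization S where
  toFun w := (fun o => ∏ i with (Quotient.mk'' i : MulAction.orbitRel.Quotient S Ω) = o, w.left i,
    Abelianization.of w.right)
  map_one' := by ext <;> simp
  map_mul' w w' := by
    refine Prod.ext (funext fun o => ?_) (by simp)
    simp only [SemidirectProduct.mul_left, Pi.mul_apply, Finset.prod_mul_distrib, Prod.mk_mul_mk]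
    congr 1
    refine Finset.prod_bij' (fun i _ => w.right⁻¹ • i) (fun i _ => w.right • i) ?_ ?_ ?_ ?_ ?_
    · intro i hi
      simp only [Finset.mem_filter, Finset.mem_univ, true_and] at hi ⊢
      rw [← hi]
      exact Quotient.sound' (MulAction.mem_orbit i w.right⁻¹)
    · intro i hi
      simp only [Finset.mem_filter, Finset.mem_univ, true_and] at hi ⊢
      rw [← hi]
      exact Quotient.sound' (MulAction.mem_orbit i w.right)
    · simp
    · simp
    · intro i _
      exact mulAutArrow_apply_eq _ _ _

theorem orbitProd_surjective : Function.Surjective (orbitProd (A := A) (S := S) (Ω := Ω)) := by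
  classical
  rintro ⟨g, x⟩
  obtain ⟨s, rfl⟩ := QuotientGroup.mk_surjective x
  -- put the prescribed value of an orbit at its chosen representative
  refine ⟨⟨fun i => if (Quotient.mk'' i : MulAction.orbitRel.Quotient S Ω).out = i
    then g (Quotient.mk'' i) else 1, s⟩, Prod.ext (funext fun o => ?_) rfl⟩
  simp only [orbitProd, MonoidHom.coe_mk, OneHom.coe_mk]
  rw [Finset.prod_eq_single o.out]
  · simp
  · intro i hi hne
    simp only [Finset.mem_filter, Finset.mem_univ, true_and] at hi
    rw [if_neg]
    rw [hi]
    exact hne.symm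
  · intro h
    simp at h

theorem ker_orbitProd : (orbitProd (A := A) (S := S) (Ω := Ω)).ker = commutator _ := by
  classical
  refine le_antisymm ?_ (Abelianization.commutator_subset_ker _)
  intro w hw
  rw [MonoidHom.mem_ker] at hw
  have h1 := fun o => congrFun (congrArg Prod.fst hw) o
  have h2 : Abelianization.of w.right = 1 := congrArg Prod.snd hw
  simp only [orbitProd, MonoidHom.coe_mk, OneHom.coe_mk, Prod.fst_one, Pi.one_apply] at h1
  rw [← Abelianization.ker_of, MonoidHom.mem_ker, ← SemidirectProduct.inl_left_mul_inr_right w,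
    map_mul]
  have hr : Abelianization.of (SemidirectProduct.inr w.right : PermWreath A S Ω) = 1 := by
    have := congrArg (Abelianization.map (SemidirectProduct.inr : S →* PermWreath A S Ω)) h2
    simpa using this
  rw [hr, mul_one]
  let F : (Ω → A) →* Abelianization (PermWreath A S Ω) :=
    Abelianization.of.comp SemidirectProduct.inl
  change F w.left = 1
  have hw' : w.left = ∏ i, Pi.mulSingle i (w.left i) := (Finset.univ_prod_mulSingle _).symm
  -- every coordinate may be moved to the representative of its orbit
  have hF : ∀ i x, F (Pi.mulSingle i x) = F (Pi.mulSingle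
      (Quotient.mk'' i : MulAction.orbitRel.Quotient S Ω).out x) := by
    intro i x
    obtain ⟨s, hs⟩ : (Quotient.mk'' i : MulAction.orbitRel.Quotient S Ω).out ∈
        MulAction.orbit S i := by
      have := Quotient.mk_out (s := MulAction.orbitRel S Ω) i
      exact this
    change s • i = _ at hs
    rw [← hs]
    exact (of_inl_mulSingle_smul s i x).symm
  rw [hw', map_prod, ← Finset.prod_fiberwise (g := fun i =>
    (Quotient.mk'' i : MulAction.orbitRel.Quotient S Ω))]
  refine Finset.prod_eq_one fun o _ => ?_
  calc _ = ∏ i with (Quotient.mk'' i : MulAction.orbitRel.Quotient S Ω) = o,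
        F (Pi.mulSingle o.out (w.left i)) := by
        refine Finset.prod_congr rfl fun i hi => ?_
        rw [hF, (Finset.mem_filter.1 hi).2]
    _ = F (Pi.mulSingle o.out
          (∏ i with (Quotient.mk'' i : MulAction.orbitRel.Quotient S Ω) = o, w.left i)) := by
        rw [← map_prod]
        congr 1
        exact (map_prod (MonoidHom.mulSingle (fun _ : Ω => A) o.out) _ _).symm
    _ = 1 := by rw [h1, Pi.mulSingle_one, map_one]

theorem commutator_permWreath_index :
    (commutator (PermWreath A S Ω)).index =
      Nat.card A ^ Nat.card (MulAction.orbitRel.Quotient S Ω) * (commutator S).index := by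
  rw [← ker_orbitProd, Subgroup.index_ker, MonoidHom.range_eq_top.2 orbitProd_surjective,
    Subgroup.card_top, Nat.card_prod, Nat.card_fun]
  rfl

theorem card_permWreath :
    Nat.card (PermWreath A S Ω) = Nat.card A ^ Fintype.card Ω * Nat.card S := by
  rw [SemidirectProduct.card, Nat.card_fun, Nat.card_eq_fintype_card (α := Ω)]

end Wreath

/-! ### Nilpotent groups with small abelianization -/

section Nilpotent

theorem commutator_eq_bot_of_isMulCommutative {G : Type*} [Group G] [IsMulCommutative G] :
    commutator G = ⊥ := by
  rw [commutator_def, Subgroup.commutator_eq_bot_iff_le_centralizer]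
  exact fun x _ y _ => mul_comm' y x

/-- A nilpotent group with cyclic abelianization is commutative: by induction along the upper
central series `G / Z(G)` is commutative, so it is its own abelianization, a quotient of that of
`G`, and is therefore cyclic. -/
theorem isMulCommutative_of_isCyclic_abelianization (G : Type*) [Group G] [Group.IsNilpotent G] :
    IsCyclic (Abelianization G) → IsMulCommutative G := by
  refine Group.nilpotent_center_quotient_ind (P := fun G _ _ =>
    IsCyclic (Abelianization G) → IsMulCommutative G) G ?_ ?_
  · intro G _ _ _
    exact ⟨⟨fun x y => Subsingleton.elim _ _⟩⟩
  · intro G _ _ ih hG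
    have hsurj : Function.Surjective
        (Abelianization.map (QuotientGroup.mk' (Subgroup.center G))) := by
      intro z
      obtain ⟨y, rfl⟩ := QuotientGroup.mk_surjective z
      obtain ⟨x, rfl⟩ := QuotientGroup.mk_surjective y
      exact ⟨Abelianization.of x, rfl⟩
    have := ih (isCyclic_of_surjective _ hsurj)
    have he : Function.Injective
        (Abelianization.of : _ →* Abelianization (G ⧸ Subgroup.center G)) := by
      rw [← MonoidHom.ker_eq_bot_iff, Abelianization.ker_of]
      exact commutator_eq_bot_of_isMulCommutative
    have hc := isCyclic_of_surjective _ hsurj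
    have : IsCyclic (G ⧸ Subgroup.center G) := isCyclic_of_injective _ he
    exact (QuotientGroup.mk' (Subgroup.center G)).isMulCommutative_of_isCyclic_of_ker_le_center
      (by simp)

theorem card_eq_of_commutator_index_eq_prime {G : Type*} [Group G] [Group.IsNilpotent G]
    {p : ℕ} [Fact p.Prime] (h : (commutator G).index = p) : Nat.card G = p := by
  have hc : IsCyclic (Abelianization G) := isCyclic_of_prime_card (p := p) h
  have := isMulCommutative_of_isCyclic_abelianization G hc
  rw [← h, commutator_eq_bot_of_isMulCommutative, Subgroup.index_bot]

theorem card_eq_one_of_commutator_index_eq_one {G : Type*} [Group G] [Group.IsNilpotent G]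
    (h : (commutator G).index = 1) : Nat.card G = 1 := by
  have hc : Nat.card (Abelianization G) = 1 := h
  have : Subsingleton (Abelianization G) := (Nat.card_eq_one_iff_unique.1 hc).1
  have := isMulCommutative_of_isCyclic_abelianization G inferInstance
  rw [← h, commutator_eq_bot_of_isMulCommutative, Subgroup.index_bot]

end Nilpotent

/-! ### Sylow 3-subgroups of symmetric groups -/

section Symmetric

variable {m : ℕ} (S : Sylow 3 (Equiv.Perm (Fin m)))

theorem card_sylow_perm : Nat.card S = 3 ^ padicValNat 3 m.factorial := by
  rw [S.card_eq_multiplicity, Nat.card_eq_fintype_card, Fintype.card_perm, Fintype.card_fin,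
    Nat.factorization_def _ Nat.prime_three]

theorem padicValNat_three_factorial_three : padicValNat 3 (Nat.factorial 3) = 1 := by
  have := padicValNat_factorial_mul (p := 3) 1
  simpa using this

theorem le_two_iff_padicValNat_factorial_eq_zero (m : ℕ) :
    m ≤ 2 ↔ padicValNat 3 m.factorial = 0 := by
  rw [padicValNat.eq_zero_iff, Nat.prime_three.dvd_factorial]
  have := m.factorial_ne_zero
  omega

theorem card_orbit_dvd_card {G Ω : Type*} [Group G] [MulAction G Ω] (x : Ω) :
    Nat.card (MulAction.orbit G x) ∣ Nat.card G := by
  rw [Nat.card_coe_set_eq, ← MulAction.index_stabilizer]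
  exact Subgroup.index_dvd_card _

theorem card_orbits_of_card_eq_one (h : Nat.card S = 1) :
    Nat.card (MulAction.orbitRel.Quotient S (Fin m)) = m := by
  have : Subsingleton S := (Nat.card_eq_one_iff_unique.1 h).1
  have hb : Function.Bijective (Quotient.mk'' : Fin m → MulAction.orbitRel.Quotient S (Fin m)) := by
    refine ⟨fun i j hij => ?_, Quotient.mk''_surjective⟩
    obtain ⟨s, hs⟩ := Quotient.exact' hij
    rw [← hs]
    simp [Subsingleton.elim s 1]
  rw [← Nat.card_eq_of_bijective _ hb, Nat.card_fin]

theorem card_orbits_eq_one_iff {G Ω : Type*} [Group G] [MulAction G Ω] :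
    Nat.card (MulAction.orbitRel.Quotient G Ω) = 1 ↔
      MulAction.IsPretransitive G Ω ∧ Nonempty Ω := by
  rw [Nat.card_eq_one_iff_unique, MulAction.pretransitive_iff_subsingleton_quotient]
  refine and_congr_right fun _ => ⟨fun ⟨x⟩ => ⟨x.out⟩, fun ⟨x⟩ => ⟨Quotient.mk'' x⟩⟩

theorem isPretransitive_sylow_perm_three (S : Sylow 3 (Equiv.Perm (Fin 3))) :
    MulAction.IsPretransitive S (Fin 3) := by
  have hS : Nat.card S = 3 := by
    rw [card_sylow_perm, padicValNat_three_factorial_three, pow_one]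
  have hdvd : ∀ i : Fin 3, Nat.card (MulAction.orbit S i) = 1 ∨
      Nat.card (MulAction.orbit S i) = 3 := fun i => by
    have h := card_orbit_dvd_card (G := S) i
    rw [hS] at h
    exact (Nat.dvd_prime Nat.prime_three).1 h
  have hex : ∃ i : Fin 3, Nat.card (MulAction.orbit S i) = 3 := by
    by_contra! hne
    have hfix : ∀ (s : S) (i : Fin 3), s • i = i := by
      intro s i
      have h1 := (Nat.card_eq_one_iff_unique.1 ((hdvd i).resolve_right (hne i))).1
      exact congrArg Subtype.val (@Subsingleton.elim _ h1 ⟨s • i, MulAction.mem_orbit i s⟩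
        ⟨i, MulAction.mem_orbit_self i⟩)
    have : Subsingleton S := ⟨fun s t => Subtype.ext (Equiv.ext fun i =>
      (hfix s i).trans (hfix t i).symm)⟩
    have := Nat.card_unique (α := S)
    omega
  obtain ⟨i, hi⟩ := hex
  rw [MulAction.isPretransitive_iff_orbit_eq_univ i, Set.eq_univ_iff_ncard]
  simpa [Nat.card_coe_set_eq] using hi

/-- For a Sylow `3`-subgroup `S` of the symmetric group on `m` points and `C` of order `3 ^ a`, the
left hand side is the order of the abelianization of `C ≀ S`. -/
theorem pow_mul_commutator_index_eq_nine_iff {a : ℕ} (ha : 1 ≤ a) :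
    (3 ^ a) ^ Nat.card (MulAction.orbitRel.Quotient S (Fin m)) * (commutator S).index = 9 ↔
      (m = 1 ∧ a = 2) ∨ ((m = 2 ∨ m = 3) ∧ a = 1) := by
  have : Fact (Nat.Prime 3) := ⟨Nat.prime_three⟩
  have hnil : Group.IsNilpotent S := S.isPGroup'.isNilpotent
  have hidx := Subgroup.index_dvd_card (commutator S)
  rw [card_sylow_perm] at hidx
  obtain ⟨s, -, hs⟩ := (Nat.dvd_prime_pow Nat.prime_three).1 hidx
  set o := Nat.card (MulAction.orbitRel.Quotient S (Fin m))
  have key : (3 ^ a) ^ o * (commutator S).index = 9 ↔ a * o + s = 2 := by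
    rw [hs, ← pow_mul, ← pow_add, show 9 = 3 ^ 2 by norm_num]
    exact Nat.pow_right_inj (by norm_num)
  rw [key]
  have hcard1 : m ≤ 2 → o = m ∧ s = 0 := by
    intro hm
    have h1 : Nat.card S = 1 := by
      rw [card_sylow_perm, (le_two_iff_padicValNat_factorial_eq_zero m).1 hm, pow_zero]
    refine ⟨card_orbits_of_card_eq_one S h1, ?_⟩
    have h2 : Nat.card S = 1 := h1
    have h3 := Subgroup.index_dvd_card (commutator S)
    rw [h2, hs, Nat.dvd_one] at h3
    simpa using h3
  have hs0 : s = 0 → m ≤ 2 := by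
    rintro rfl
    have := card_eq_one_of_commutator_index_eq_one hs
    rw [card_sylow_perm] at this
    rw [le_two_iff_padicValNat_factorial_eq_zero]
    simpa using this
  have hs1 : s = 1 → Nat.card S = 3 := by
    rintro rfl
    exact card_eq_of_commutator_index_eq_prime hs
  constructor
  · intro h
    by_cases hm : m ≤ 2
    · obtain ⟨h1, h2⟩ := hcard1 hm
      rw [h1, h2, add_zero] at h
      have hm0 : m = 0 ∨ m = 1 ∨ m = 2 := by omega
      clear * - h hm0
      rcases hm0 with rfl | rfl | rfl <;> omega
    · have hspos : s ≠ 0 := fun h0 => hm (hs0 h0)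
      have hne : Nonempty (Fin m) := ⟨⟨0, by omega⟩⟩
      have hopos : 0 < o := Nat.card_pos_iff.2 ⟨⟨Quotient.mk'' hne.some⟩, inferInstance⟩
      have : 1 ≤ a * o := Nat.mul_pos ha hopos
      -- both summands of `a * o + s = 2` are positive
      have hprod : a * o = 1 := by omega
      obtain ⟨ha1, ho1⟩ := mul_eq_one.1 hprod
      have hS3 := hs1 (by omega)
      obtain ⟨htr, -⟩ := card_orbits_eq_one_iff.1 ho1
      have hdvd : m ∣ 3 := by
        have := card_orbit_dvd_card (G := S) hne.some
        rwa [MulAction.orbit_eq_univ, Nat.card_univ, Nat.card_fin, hS3] at this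
      have := (Nat.dvd_prime Nat.prime_three).1 hdvd
      omega
  · rintro (⟨rfl, rfl⟩ | ⟨rfl | rfl, rfl⟩)
    · obtain ⟨h1, h2⟩ := hcard1 (by omega)
      rw [h1, h2]
    · obtain ⟨h1, h2⟩ := hcard1 (by omega)
      rw [h1, h2]
    · have ho1 : o = 1 := card_orbits_eq_one_iff.2 ⟨isPretransitive_sylow_perm_three S, ⟨0⟩⟩
      have hS : Nat.card S = 3 := by
        rw [card_sylow_perm, padicValNat_three_factorial_three, pow_one]
      have h3 := Subgroup.index_dvd_card (commutator S)
      rw [hS, hs, ← pow_one 3, ← pow_mul, Nat.pow_dvd_pow_iff_le_right (by norm_num)] at h3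
      have : s ≠ 0 := fun h0 => by have := hs0 h0; omega
      omega

end Symmetric

/-! ### The `3`-part of the group order -/

/-- Lifting the exponent for integers, in terms of `padicValInt`. -/
theorem padicValInt_pow_sub_pow {p : ℕ} (hp : p.Prime) (hodd : Odd p) {x y : ℤ}
    (hxy : (p : ℤ) ∣ x - y) (hx : ¬ (p : ℤ) ∣ x) {d : ℕ} (hd : d ≠ 0) (hne : x - y ≠ 0)
    (hne' : x ^ d - y ^ d ≠ 0) :
    padicValInt p (x ^ d - y ^ d) = padicValInt p (x - y) + padicValNat p d := by
  have : Fact p.Prime := ⟨hp⟩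
  have h := Int.emultiplicity_pow_sub_pow hp hodd hxy hx d
  rw [← Int.emultiplicity_natAbs, ← Int.emultiplicity_natAbs,
    ← padicValNat_eq_emultiplicity (Int.natAbs_ne_zero.2 hne'),
    ← padicValNat_eq_emultiplicity (Int.natAbs_ne_zero.2 hne),
    ← padicValNat_eq_emultiplicity hd] at h
  exact_mod_cast h

theorem pow_sub_units_pow_ne_zero {q : ℕ} (hq : 2 ≤ q) (ε : ℤˣ) {d : ℕ} (hd : d ≠ 0) :
    (q : ℤ) ^ d - (ε : ℤ) ^ d ≠ 0 := by
  intro h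
  have h1 := congrArg Int.natAbs (sub_eq_zero.1 h)
  rw [Int.natAbs_pow, Int.natAbs_pow, Int.units_natAbs, one_pow, Int.natAbs_natCast] at h1
  have := Nat.one_lt_pow hd hq
  omega

/-- If `3 ∣ q - ε`, every factor `q ^ d - ε ^ d` contributes the valuations of `q - ε` and of
`d`. -/
theorem padicValInt_prod_of_three_dvd_sub {q : ℕ} (hq : 2 ≤ q) (ε : ℤˣ)
    (h3 : (3 : ℤ) ∣ q - ε) (n : ℕ) :
    padicValInt 3 (∏ d ∈ Finset.range n, (q : ℤ) ^ d * ((q : ℤ) ^ (d + 1) - (ε : ℤ) ^ (d + 1))) =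
      padicValInt 3 (q - ε) * n + padicValNat 3 n.factorial := by
  have : Fact (Nat.Prime 3) := ⟨Nat.prime_three⟩
  have hq0 : (q : ℤ) ≠ 0 := by omega
  have hq3 : ¬ (3 : ℤ) ∣ q := by
    rcases Int.units_eq_one_or ε with rfl | rfl <;> simp at h3 <;> omega
  have hne {d : ℕ} (hd : d ≠ 0) := pow_sub_units_pow_ne_zero hq ε hd
  induction n with
  | zero => simp
  | succ n ih =>
    rw [Finset.prod_range_succ, padicValInt.mul, ih, padicValInt.mul, Nat.factorial_succ,
      padicValNat.mul (by omega) n.factorial_ne_zero,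
      padicValInt_pow_sub_pow Nat.prime_three (by decide) h3 hq3 (by omega)
        (by simpa using hne one_ne_zero) (hne (by omega)),
      padicValInt.eq_zero_of_not_dvd (fun h => hq3 (Int.prime_three.dvd_of_dvd_pow h))]
    · ring
    · exact pow_ne_zero _ hq0
    · exact hne (by omega)
    · exact Finset.prod_ne_zero_iff.2 fun d _ => mul_ne_zero (pow_ne_zero _ hq0) (hne (by omega))
    · exact mul_ne_zero (pow_ne_zero _ hq0) (hne (by omega))

/-- If `3 ∣ q + ε`, the factors `q ^ d - ε ^ d` with `d` odd are prime to `3`, and lifting the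
exponent for `q ^ 2` and `ε ^ 2` applies to those with `d` even. -/
theorem padicValInt_prod_of_three_dvd_add {q : ℕ} (hq : 2 ≤ q) (ε : ℤˣ)
    (h3 : (3 : ℤ) ∣ q + ε) (n : ℕ) :
    padicValInt 3 (∏ d ∈ Finset.range n, (q : ℤ) ^ d * ((q : ℤ) ^ (d + 1) - (ε : ℤ) ^ (d + 1))) =
      padicValInt 3 (q + ε) * (n / 2) + padicValNat 3 (n / 2).factorial := by
  have : Fact (Nat.Prime 3) := ⟨Nat.prime_three⟩
  have hq0 : (q : ℤ) ≠ 0 := by omega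
  have hq3 : ¬ (3 : ℤ) ∣ q := by
    rcases Int.units_eq_one_or ε with rfl | rfl <;> simp at h3 <;> omega
  have hqε : ¬ (3 : ℤ) ∣ q - ε := by
    rcases Int.units_eq_one_or ε with rfl | rfl <;> simp at h3 ⊢ <;> omega
  have hne {d : ℕ} (hd : d ≠ 0) := pow_sub_units_pow_ne_zero hq ε hd
  have hsq : ((q : ℤ) ^ 2 - (ε : ℤ) ^ 2) = (q + ε) * (q - ε) := by ring
  have hadd : (q : ℤ) + ε ≠ 0 := fun h => hne two_ne_zero (by rw [hsq, h, zero_mul])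
  have hval2 : padicValInt 3 ((q : ℤ) ^ 2 - (ε : ℤ) ^ 2) = padicValInt 3 (q + ε) := by
    rw [hsq, padicValInt.mul hadd (by simpa using hne one_ne_zero),
      padicValInt.eq_zero_of_not_dvd hqε, add_zero]
  have heven : ∀ k : ℕ, k ≠ 0 → padicValInt 3 ((q : ℤ) ^ (2 * k) - (ε : ℤ) ^ (2 * k)) =
      padicValInt 3 (q + ε) + padicValNat 3 k := by
    intro k hk
    rw [← hval2, pow_mul, pow_mul]
    refine padicValInt_pow_sub_pow Nat.prime_three (by decide) ?_ ?_ hk (hne two_ne_zero) ?_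
    · rw [hsq]
      exact Dvd.dvd.mul_right h3 _
    · exact fun h => hq3 (Int.prime_three.dvd_of_dvd_pow h)
    · rw [← pow_mul, ← pow_mul]
      exact hne (by omega)
  have hodd : ∀ k : ℕ, padicValInt 3 ((q : ℤ) ^ (2 * k + 1) - (ε : ℤ) ^ (2 * k + 1)) = 0 := by
    intro k
    refine padicValInt.eq_zero_of_not_dvd fun h => ?_
    have h1 : (3 : ℤ) ∣ (q : ℤ) ^ (2 * k + 1) + (ε : ℤ) ^ (2 * k + 1) :=
      h3.trans (Odd.add_dvd_pow_add_pow _ _ ⟨k, rfl⟩)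
    have h2 : (3 : ℤ) ∣ 2 * (q : ℤ) ^ (2 * k + 1) := by
      have := dvd_add h h1
      rwa [show (q : ℤ) ^ (2 * k + 1) - (ε : ℤ) ^ (2 * k + 1) +
        ((q : ℤ) ^ (2 * k + 1) + (ε : ℤ) ^ (2 * k + 1)) = 2 * (q : ℤ) ^ (2 * k + 1) by ring] at this
    rcases Int.prime_three.dvd_or_dvd h2 with h | h
    · omega
    · exact hq3 (Int.prime_three.dvd_of_dvd_pow h)
  induction n with
  | zero => simp
  | succ n ih =>
    rw [Finset.prod_range_succ, padicValInt.mul, ih, padicValInt.mul,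
      padicValInt.eq_zero_of_not_dvd (z := (q : ℤ) ^ n)
        (fun h => hq3 (Int.prime_three.dvd_of_dvd_pow h))]
    · obtain ⟨k, rfl | rfl⟩ := Nat.even_or_odd' n
      · rw [hodd, show (2 * k + 1) / 2 = k by omega, show 2 * k / 2 = k by omega]
        ring
      · rw [show 2 * k + 1 + 1 = 2 * (k + 1) by ring, heven _ (by omega),
          show (2 * k + 1) / 2 = k by omega, show 2 * (k + 1) / 2 = k + 1 by omega,
          Nat.factorial_succ, padicValNat.mul (by omega) k.factorial_ne_zero]
        ring
    · exact pow_ne_zero _ hq0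
    · exact hne (by omega)
    · exact Finset.prod_ne_zero_iff.2 fun d _ => mul_ne_zero (pow_ne_zero _ hq0) (hne (by omega))
    · exact mul_ne_zero (pow_ne_zero _ hq0) (hne (by omega))

/-- The order of `GL_n(q)`, in a form parallel to `card_isometrySubgroup`. -/
theorem card_GL_eq_prod {F : Type*} [Field F] [Finite F] {q : ℕ} (hF : Nat.card F = q) (n : ℕ) :
    (Nat.card (GL (Fin n) F) : ℤ) =
      ∏ d ∈ Finset.range n, (q : ℤ) ^ d * ((q : ℤ) ^ (d + 1) - 1) := by
  have := Fintype.ofFinite F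
  rw [Matrix.card_GL_field, ← Nat.card_eq_fintype_card, hF,
    Fin.prod_univ_eq_prod_range (fun i => q ^ n - q ^ i) n]
  have hq : 1 ≤ q := hF ▸ Nat.card_pos
  push_cast
  rw [Finset.prod_mul_distrib, ← Finset.prod_range_reflect (fun d => (q : ℤ) ^ (d + 1) - 1),
    ← Finset.prod_mul_distrib]
  refine Finset.prod_congr rfl fun i hi => ?_
  have hi := Finset.mem_range.1 hi
  rw [Nat.cast_sub (Nat.pow_le_pow_right hq hi.le), show n - 1 - i + 1 = n - i by omega, mul_sub,
    mul_one, ← pow_add, Nat.add_sub_cancel' hi.le]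
  push_cast
  rfl

/-! ### The order of the finite unitary group -/

section Unitary

variable {F : Type*} [Field F] {q : ℕ}

theorem two_le_of_card_eq_sq [Finite F] (hF : Nat.card F = q ^ 2) : 2 ≤ q := by
  by_contra! h
  have h1 : 1 < Nat.card F := Finite.one_lt_card
  rw [hF] at h1
  interval_cases q <;> omega

/-- The norm map from `𝔽_{q²}` to `𝔽_q` takes every nonzero value `q + 1` times. -/
theorem card_pow_eq_of_pow_eq_self [Finite F] (hF : Nat.card F = q ^ 2) {s : F}
    (hs : s ^ q = s) (hs0 : s ≠ 0) :
    Nat.card {c : F // c ^ (q + 1) = s} = q + 1 := by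
  have hq : 2 ≤ q := two_le_of_card_eq_sq hF
  have hcu : Nat.card Fˣ = (q - 1) * (q + 1) := by
    rw [Nat.card_units, hF, mul_comm, ← Nat.sq_sub_sq, one_pow]
  let N : Fˣ →* Fˣ := powMonoidHom (q + 1)
  have hker : Nat.card N.ker = q + 1 := by
    rw [IsCyclic.card_powMonoidHom_ker, hcu]
    exact Nat.gcd_eq_right (Dvd.intro_left _ rfl)
  have hrange : N.range = (powMonoidHom (q - 1) : Fˣ →* Fˣ).ker := by
    -- the norms are contained in the `(q - 1)`-torsion, and there are `q - 1` of either
    have hle : N.range ≤ (powMonoidHom (q - 1) : Fˣ →* Fˣ).ker := by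
      rintro _ ⟨x, rfl⟩
      rw [MonoidHom.mem_ker, powMonoidHom_apply, powMonoidHom_apply, ← pow_mul, mul_comm, ← hcu]
      exact pow_card_eq_one'
    refine Subgroup.eq_of_le_of_card_ge hle ?_
    rw [IsCyclic.card_powMonoidHom_ker, IsCyclic.card_powMonoidHom_range, hcu,
      Nat.gcd_eq_right (Dvd.intro _ rfl), Nat.gcd_eq_right (Dvd.intro_left _ rfl),
      Nat.mul_div_cancel _ (by omega)]
  have hmem : Units.mk0 s hs0 ∈ N.range := by
    rw [hrange, MonoidHom.mem_ker]
    apply Units.ext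
    apply mul_right_cancel₀ hs0
    simp [← pow_succ, Nat.sub_add_cancel (show 1 ≤ q by omega), hs]
  obtain ⟨x, hx⟩ := hmem
  have hx' : (x : F) ^ (q + 1) = s := congrArg Units.val hx
  have hne : ∀ c : {c : F // c ^ (q + 1) = s}, c.1 ≠ 0 := fun c h => hs0 <| by
    rw [← c.2, h, zero_pow (by omega)]
  have h1 : ∀ c : {c : F // c ^ (q + 1) = s}, Units.mk0 c.1 (hne c) * x⁻¹ ∈ N.ker := by
    intro c
    rw [MonoidHom.mem_ker, map_mul, map_inv, hx, mul_inv_eq_one]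
    exact Units.ext c.2
  have h2 : ∀ y : N.ker, ((y.1 * x : Fˣ) : F) ^ (q + 1) = s := by
    intro y
    have := congrArg Units.val (MonoidHom.mem_ker.1 y.2)
    simp only [N, powMonoidHom_apply, Units.val_pow_eq_pow_val, Units.val_one] at this
    rw [Units.val_mul, mul_pow, this, one_mul, hx']
  have e : {c : F // c ^ (q + 1) = s} ≃ N.ker :=
    { toFun := fun c => ⟨Units.mk0 c.1 (hne c) * x⁻¹, h1 c⟩
      invFun := fun y => ⟨((y.1 * x : Fˣ) : F), h2 y⟩
      left_inv := fun c => by simp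
      right_inv := fun y => by
        ext
        simp }
  rw [Nat.card_congr e, hker]

/-- The standard `σ`-sesquilinear form `⟨x, y⟩ = ∑ i, σ (x i) * y i`. -/
def sesqForm (σ : F →+* F) {n : ℕ} (x y : Fin n → F) : F := (σ ∘ x) ⬝ᵥ y

/-- The vectors orthogonal to all members of a family. -/
def perp (σ : F →+* F) {n k : ℕ} (v : Fin k → Fin n → F) : Set (Fin n → F) :=
  {w | ∀ i, sesqForm σ (v i) w = 0}

/-- A frame: a family that is orthonormal for the sesquilinear form. -/
def IsFrame (σ : F →+* F) {n k : ℕ} (v : Fin k → Fin n → F) : Prop :=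
  ∀ i j, sesqForm σ (v i) (v j) = if i = j then 1 else 0

section Form

variable {σ : F →+* F} {n k : ℕ}

theorem sesqForm_add_right (x y z : Fin n → F) :
    sesqForm σ x (y + z) = sesqForm σ x y + sesqForm σ x z := dotProduct_add _ _ _

theorem sesqForm_sub_right (x y z : Fin n → F) :
    sesqForm σ x (y - z) = sesqForm σ x y - sesqForm σ x z := dotProduct_sub _ _ _

theorem sesqForm_smul_right (c : F) (x y : Fin n → F) :
    sesqForm σ x (c • y) = c * sesqForm σ x y := dotProduct_smul _ _ _

theorem map_map_of_card_eq_sq [Finite F] (hF : Nat.card F = q ^ 2) (hσ : ∀ x, σ x = x ^ q) (x : F) :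
    σ (σ x) = x := by
  have := Fintype.ofFinite F
  rw [hσ, hσ, ← pow_mul, ← sq, ← hF, Nat.card_eq_fintype_card, FiniteField.pow_card]

theorem map_sesqForm (hσσ : ∀ x, σ (σ x) = x) (x y : Fin n → F) :
    σ (sesqForm σ x y) = sesqForm σ y x := by
  simp only [sesqForm, dotProduct, Function.comp_apply, map_sum, map_mul, hσσ]
  exact Finset.sum_congr rfl fun i _ => mul_comm _ _

theorem sesqForm_eq_zero_comm (hσσ : ∀ x, σ (σ x) = x) {x y : Fin n → F}
    (h : sesqForm σ x y = 0) : sesqForm σ y x = 0 := by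
  rw [← map_sesqForm hσσ, h, map_zero]

theorem sesqForm_add_smul_self (hσσ : ∀ x, σ (σ x) = x) {u w : Fin n → F}
    (huw : sesqForm σ u w = 0) (hu : sesqForm σ u u = 1) (c : F) :
    sesqForm σ (w + c • u) (w + c • u) = sesqForm σ w w + σ c * c := by
  have h1 : sesqForm σ (w + c • u) u = σ c := by
    rw [← map_sesqForm hσσ, sesqForm_add_right, huw, sesqForm_smul_right, hu, zero_add, mul_one]
  have h2 : sesqForm σ (w + c • u) w = sesqForm σ w w := by
    rw [← map_sesqForm hσσ, sesqForm_add_right, sesqForm_smul_right,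
      sesqForm_eq_zero_comm hσσ huw, mul_zero, add_zero, map_sesqForm hσσ]
  rw [sesqForm_add_right, sesqForm_smul_right, h1, h2, mul_comm]

/-- Splitting off the last vector of an orthonormal family from the complement of the others. -/
def perpInitEquiv (v : Fin (k + 1) → Fin n → F) (hv : IsFrame σ v) :
    perp σ (fun i : Fin k => v i.castSucc) ≃ F × perp σ v where
  toFun w := (sesqForm σ (v (Fin.last k)) w.1,
    ⟨w.1 - sesqForm σ (v (Fin.last k)) w.1 • v (Fin.last k), by
      intro i
      rw [sesqForm_sub_right, sesqForm_smul_right, hv]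
      refine Fin.lastCases ?_ (fun i => ?_) i
      · simp
      · rw [w.2 i, if_neg (Fin.castSucc_lt_last i).ne]
        simp⟩)
  invFun x := ⟨x.2.1 + x.1 • v (Fin.last k), by
    intro i
    rw [sesqForm_add_right, sesqForm_smul_right, hv, x.2.2, if_neg (Fin.castSucc_lt_last i).ne]
    simp⟩
  left_inv w := by simp
  right_inv x := by
    have : sesqForm σ (v (Fin.last k)) (x.2.1 + x.1 • v (Fin.last k)) = x.1 := by
      rw [sesqForm_add_right, sesqForm_smul_right, hv, x.2.2]
      simp
    ext1
    · exact this
    · apply Subtype.ext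
      simp only [this]
      simp

theorem IsFrame.castSucc {v : Fin (k + 1) → Fin n → F} (hv : IsFrame σ v) :
    IsFrame σ (fun i : Fin k => v i.castSucc) := by
  intro i j
  rw [hv]
  simp

variable (σ) in
/-- The unit vectors in the complement of a family. -/
abbrev UnitPerp (v : Fin k → Fin n → F) : Type _ :=
  {w : Fin n → F // w ∈ perp σ v ∧ sesqForm σ w w = 1}

/-- Let `u` be the last vector of an orthonormal family `v`. A unit vector orthogonal to the other
vectors of `v` is `w + c • u` with `w` orthogonal to all of `v` and `c ^ (q + 1) = 1 - ⟨w, w⟩`.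
There is one such `c` if `⟨w, w⟩ = 1`, and there are `q + 1` otherwise. -/
theorem card_unitPerp_castSucc_add [Finite F] (hF : Nat.card F = q ^ 2) (hσ : ∀ x, σ x = x ^ q)
    (v : Fin (k + 1) → Fin n → F) (hv : IsFrame σ v) :
    Nat.card (UnitPerp σ fun i : Fin k => v i.castSucc) + q * Nat.card (UnitPerp σ v) =
      (q + 1) * Nat.card (perp σ v) := by
  classical
  have hσσ := map_map_of_card_eq_sq hF hσ
  have hiff : ∀ w : perp σ (fun i : Fin k => v i.castSucc), sesqForm σ w.1 w.1 = 1 ↔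
      (perpInitEquiv v hv w).1 ^ (q + 1) =
        1 - sesqForm σ (perpInitEquiv v hv w).2.1 (perpInitEquiv v hv w).2.1 := by
    intro w
    obtain ⟨x, rfl⟩ := (perpInitEquiv v hv).symm.surjective w
    rw [Equiv.apply_symm_apply, eq_sub_iff_add_eq', pow_succ, ← hσ, ← sesqForm_add_smul_self hσσ
      (x.2.2 _) ((hv _ _).trans (if_pos rfl))]
    rfl
  let e : (UnitPerp σ fun i : Fin k => v i.castSucc) ≃
      Σ w : perp σ v, {c : F // c ^ (q + 1) = 1 - sesqForm σ w.1 w.1} :=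
    (Equiv.subtypeSubtypeEquivSubtypeInter _ _).symm.trans <|
      ((perpInitEquiv v hv).subtypeEquiv (q := fun x => x.1 ^ (q + 1) = 1 - sesqForm σ x.2.1 x.2.1)
        hiff).trans
      { toFun := fun x => ⟨x.1.2, x.1.1, x.2⟩
        invFun := fun y => ⟨(y.2.1, y.1), y.2.2⟩
        left_inv := fun _ => rfl
        right_inv := fun _ => rfl }
  have := Fintype.ofFinite (perp σ v)
  have hU : Nat.card (UnitPerp σ v) = ∑ w : perp σ v, if sesqForm σ w.1 w.1 = 1 then 1 else 0 := by
    rw [← Nat.card_congr (Equiv.subtypeSubtypeEquivSubtypeInter (· ∈ perp σ v)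
      (fun w => sesqForm σ w w = 1)), Finset.sum_boole, Nat.card_eq_fintype_card,
      Fintype.card_subtype]
    rfl
  rw [Nat.card_congr e, Nat.card_sigma, hU, Finset.mul_sum, ← Finset.sum_add_distrib,
    Nat.card_eq_fintype_card, ← Finset.card_univ, mul_comm, ← smul_eq_mul, ← Finset.sum_const]
  refine Finset.sum_congr rfl fun w _ => ?_
  split_ifs with h
  · have : Unique {c : F // c ^ (q + 1) = 1 - sesqForm σ w.1 w.1} :=
      ⟨⟨⟨0, by simp [h]⟩⟩, fun c => Subtype.ext (by
        exact (pow_eq_zero_iff (by omega)).1 (c.2.trans (by rw [h, sub_self])))⟩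
    rw [Nat.card_unique]
    ring
  · rw [card_pow_eq_of_pow_eq_self hF, mul_zero, add_zero]
    · rw [← hσ, map_sub, map_one, map_sesqForm hσσ]
    · exact sub_ne_zero.2 (Ne.symm h)

theorem card_perp_mul [Finite F] (hF : Nat.card F = q ^ 2) (v : Fin k → Fin n → F)
    (hv : IsFrame σ v) :
    Nat.card (perp σ v) * (q ^ 2) ^ k = (q ^ 2) ^ n := by
  induction k with
  | zero =>
    have : perp σ v = Set.univ := Set.eq_univ_of_forall fun w i => i.elim0
    rw [this, Nat.card_univ, Nat.card_fun, hF, Nat.card_fin, pow_zero, mul_one]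
  | succ k ih =>
    rw [← ih _ hv.castSucc, Nat.card_congr (perpInitEquiv v hv), Nat.card_prod, hF]
    ring

theorem card_perp [Finite F] (hF : Nat.card F = q ^ 2) (v : Fin k → Fin n → F)
    (hv : IsFrame σ v) {d : ℕ} (hd : k + d = n) : Nat.card (perp σ v) = q ^ (2 * d) := by
  have hq := two_le_of_card_eq_sq hF
  have hn : (q ^ 2) ^ n = q ^ (2 * k) * q ^ (2 * d) := by rw [← hd]; ring
  have := card_perp_mul hF v hv
  rw [hn, ← pow_mul, mul_comm] at this
  exact Nat.eq_of_mul_eq_mul_left (by positivity) this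

variable (q) in
/-- The number of unit vectors in a nondegenerate Hermitian space of dimension `d`. The truncated
subtraction at `d = 0` is harmless, since then the other factor vanishes. -/
def unitCount (d : ℕ) : ℤ := (q : ℤ) ^ (d - 1) * ((q : ℤ) ^ d - (-1) ^ d)

theorem unitCount_succ_add (d : ℕ) :
    unitCount q (d + 1) + q * unitCount q d = (q + 1) * (q : ℤ) ^ (2 * d) := by
  rcases d with - | d
  · simp [unitCount]
  · simp only [unitCount, Nat.add_sub_cancel]
    ring

theorem unitPerp_recursion [Finite F] (hF : Nat.card F = q ^ 2) (hσ : ∀ x, σ x = x ^ q)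
    (v : Fin (k + 1) → Fin n → F) (hv : IsFrame σ v) {d : ℕ} (hd : k + 1 + d = n) :
    (Nat.card (UnitPerp σ fun i : Fin k => v i.castSucc) : ℤ) + q * Nat.card (UnitPerp σ v) =
      unitCount q (d + 1) + q * unitCount q d := by
  rw [unitCount_succ_add]
  have := card_unitPerp_castSucc_add hF hσ v hv
  rw [card_perp hF v hv hd] at this
  exact_mod_cast this

theorem isFrame_single (h : k ≤ n) :
    IsFrame σ (fun i : Fin k => (Pi.single (Fin.castLE h i) 1 : Fin n → F)) := by
  intro i j
  rw [sesqForm, dotProduct_single, Function.comp_apply, mul_one]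
  simp only [Pi.single_apply]
  simp only [Fin.castLE_inj, eq_comm (a := j)]
  split_ifs <;> simp

/-- The count for an initial segment of the standard basis, by induction on the dimension `d` of its
complement. The standard basis guarantees that the family extends. -/
theorem card_unitPerp_single [Finite F] (hF : Nat.card F = q ^ 2) (hσ : ∀ x, σ x = x ^ q) (d : ℕ) :
    ∀ (k : ℕ) (h : k + d = n), (Nat.card (UnitPerp σ fun i : Fin k =>
      (Pi.single (Fin.castLE (by omega : k ≤ n) i) 1 : Fin n → F)) : ℤ) = unitCount q d := by
  induction d with
  | zero =>
    intro k h
    have hc := card_perp hF _ (isFrame_single (σ := σ) (n := n) (k := k) (by omega)) h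
    rw [mul_zero, pow_zero] at hc
    have hs := (Nat.card_eq_one_iff_unique.1 hc).1
    rw [Set.subsingleton_coe] at hs
    have : IsEmpty (UnitPerp σ fun i : Fin k =>
        (Pi.single (Fin.castLE (by omega : k ≤ n) i) 1 : Fin n → F)) := ⟨fun w => by
      have h0 : w.1 = 0 := hs w.2.1 fun i => by simp [sesqForm]
      have := w.2.2
      rw [h0] at this
      simp [sesqForm] at this⟩
    simp [unitCount]
  | succ d ih =>
    intro k h
    have := unitPerp_recursion hF hσ _
      (isFrame_single (σ := σ) (n := n) (k := k + 1) (by omega)) (d := d) (by omega)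
    rw [ih (k + 1) (by omega)] at this
    exact add_right_cancel this

/-- The count for an arbitrary orthonormal family. The recursion `unitPerp_recursion` determines the
count for `v` from the one without the last vector, so that an induction on `k` starting from the
empty family, where `card_unitPerp_single` applies, gives the result without extending `v` to an
orthonormal basis. -/
theorem card_unitPerp [Finite F] (hF : Nat.card F = q ^ 2) (hσ : ∀ x, σ x = x ^ q)
    (v : Fin k → Fin n → F) (hv : IsFrame σ v) {d : ℕ} (hd : k + d = n) :
    (Nat.card (UnitPerp σ v) : ℤ) = unitCount q d := by
  induction k generalizing d with
  | zero =>
    rw [← card_unitPerp_single (σ := σ) (n := n) hF hσ d 0 hd]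
    congr
    exact Subsingleton.elim _ _
  | succ k ih =>
    have := unitPerp_recursion hF hσ v hv hd
    rw [ih _ hv.castSucc (d := d + 1) (by omega)] at this
    have hq := two_le_of_card_eq_sq hF
    exact mul_left_cancel₀ (by omega) (add_left_cancel this)

theorem IsFrame.snoc (hσσ : ∀ x, σ (σ x) = x) {v : Fin k → Fin n → F} (hv : IsFrame σ v)
    (w : UnitPerp σ v) : IsFrame σ (Fin.snoc v w.1 : Fin (k + 1) → Fin n → F) := by
  intro i j
  refine Fin.lastCases ?_ (fun i => ?_) i <;> refine Fin.lastCases ?_ (fun j => ?_) j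
  · simpa using w.2.2
  · simpa [(Fin.castSucc_lt_last j).ne'] using sesqForm_eq_zero_comm hσσ (w.2.1 j)
  · simpa [(Fin.castSucc_lt_last i).ne] using w.2.1 i
  · simpa using hv i j

/-- An orthonormal family of `k + 1` vectors is one of `k` vectors together with a unit vector in
its complement. -/
def frameSuccEquiv (hσσ : ∀ x, σ (σ x) = x) :
    {v : Fin (k + 1) → Fin n → F // IsFrame σ v} ≃
      Σ v : {v : Fin k → Fin n → F // IsFrame σ v}, UnitPerp σ v.1 where
  toFun v := ⟨⟨fun i => v.1 i.castSucc, v.2.castSucc⟩, v.1 (Fin.last k), fun i => by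
    rw [v.2, if_neg (Fin.castSucc_lt_last i).ne], by rw [v.2, if_pos rfl]⟩
  invFun x := ⟨Fin.snoc x.1.1 x.2.1, x.1.2.snoc hσσ x.2⟩
  left_inv v := Subtype.ext (Fin.snoc_init_self v.1)
  right_inv x := by
    refine Sigma.subtype_ext (Subtype.ext ?_) ?_ <;> simp

theorem card_frames [Finite F] (hF : Nat.card F = q ^ 2) (hσ : ∀ x, σ x = x ^ q) {k : ℕ}
    (hk : k ≤ n) :
    (Nat.card {v : Fin k → Fin n → F // IsFrame σ v} : ℤ) =
      ∏ i ∈ Finset.range k, unitCount q (n - i) := by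
  induction k with
  | zero =>
    have : Unique {v : Fin 0 → Fin n → F // IsFrame σ v} :=
      ⟨⟨⟨Fin.elim0, fun i => i.elim0⟩⟩, fun v => Subtype.ext (Subsingleton.elim _ _)⟩
    simp
  | succ k ih =>
    have := Fintype.ofFinite {v : Fin k → Fin n → F // IsFrame σ v}
    rw [Nat.card_congr (frameSuccEquiv (map_map_of_card_eq_sq hF hσ)), Nat.card_sigma,
      Finset.prod_range_succ, ← ih (by omega), Nat.card_eq_fintype_card]
    push_cast
    rw [Finset.sum_congr rfl fun v _ => card_unitPerp hF hσ v.1 v.2 (d := n - k) (by omega),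
      Finset.sum_const, Finset.card_univ, nsmul_eq_mul]

theorem map_transpose_mul_eq_one_iff (A : Matrix (Fin n) (Fin n) F) :
    (A.map σ)ᵀ * A = 1 ↔ IsFrame σ Aᵀ := by
  rw [← Matrix.ext_iff]
  refine forall₂_congr fun i j => ?_
  rw [Matrix.one_apply]
  rfl

/-- A matrix preserves the form if and only if its columns are orthonormal. -/
def isometryEquivFrames : isometrySubgroup n σ ≃ {v : Fin n → Fin n → F // IsFrame σ v} where
  toFun := fun A => ⟨(A.1 : Matrix (Fin n) (Fin n) F)ᵀ, (map_transpose_mul_eq_one_iff _).1 A.2⟩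
  invFun v :=
    have h := (map_transpose_mul_eq_one_iff (σ := σ) (Matrix.of v.1)ᵀ).2 v.2
    ⟨⟨(Matrix.of v.1)ᵀ, ((Matrix.of v.1)ᵀ.map σ)ᵀ, mul_eq_one_comm.1 h, h⟩, h⟩
  left_inv _ := Subtype.ext (Units.ext rfl)
  right_inv _ := rfl

/-- The order of the unitary group `GU_n(q)`. -/
theorem card_isometrySubgroup [Finite F] (hF : Nat.card F = q ^ 2) (hσ : ∀ x, σ x = x ^ q) :
    (Nat.card (isometrySubgroup n σ) : ℤ) =
      ∏ d ∈ Finset.range n, (q : ℤ) ^ d * ((q : ℤ) ^ (d + 1) - (-1) ^ (d + 1)) := by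
  rw [Nat.card_congr isometryEquivFrames, card_frames hF hσ le_rfl,
    ← Finset.prod_range_reflect]
  refine Finset.prod_congr rfl fun i hi => ?_
  have hi := Finset.mem_range.1 hi
  rw [show n - (n - 1 - i) = i + 1 by omega, unitCount, Nat.add_sub_cancel]

end Form

end Unitary

/-! ### Block monomial matrices -/

section BlockMonomial

variable {R Q S Ω β γ : Type*} [CommRing R] [CommGroup Q] [Group S] [MulAction S Ω]
  [Fintype Ω] [DecidableEq Ω] [Fintype β] [DecidableEq β] [Fintype γ] [DecidableEq γ]

/-- The block monomial matrices attached to a wreath product `Q ≀ S` and a matrix representation `ρ`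
of `Q`: the block in row `i` and column `j` is `ρ` of the `i`-th coordinate if the permutation maps
`j` to `i`, and zero otherwise. -/
def wreathMatrix (ρ : Q →* Matrix β β R) :
    PermWreath Q S Ω →* Matrix (Ω × β) (Ω × β) R where
  toFun w := Matrix.of fun x y => if x.1 = w.right • y.1 then ρ (w.left x.1) x.2 y.2 else 0
  map_one' := by
    ext ⟨i, s⟩ ⟨j, t⟩
    simp [Matrix.one_apply, Prod.ext_iff, ite_and]
  map_mul' w w' := by
    ext ⟨i, s⟩ ⟨j, t⟩
    simp only [Matrix.of_apply, Matrix.mul_apply, Fintype.sum_prod_type, mul_ite, mul_zero, ite_mul,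
      zero_mul, SemidirectProduct.mul_right, SemidirectProduct.mul_left, Pi.mul_apply, map_mul,
      mulAutArrow_apply_eq, mul_smul]
    rw [Finset.sum_eq_single (w'.right • j)]
    · by_cases h : i = w.right • w'.right • j <;> simp [h]
    · intro k _ hk
      simp [hk]
    · simp

theorem wreathMatrix_injective {ρ : Q →* Matrix β β R} (hρ : Function.Injective ρ) [Nontrivial R]
    [FaithfulSMul S Ω] [Nonempty β] : Function.Injective (wreathMatrix (S := S) (Ω := Ω) ρ) := by
  rw [injective_iff_map_eq_one]
  intro w hw
  have hw' : ∀ x y : Ω × β, (if x.1 = w.right • y.1 then ρ (w.left x.1) x.2 y.2 else 0) =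
      (1 : Matrix (Ω × β) (Ω × β) R) x y := fun x y => congrFun (congrFun hw x) y
  have hr : w.right = 1 := by
    refine FaithfulSMul.eq_of_smul_eq_smul (α := Ω) fun i => ?_
    by_contra hne
    obtain ⟨s⟩ := ‹Nonempty β›
    have := hw' (i, s) (i, s)
    rw [one_smul] at hne
    rw [if_neg (fun h => hne h.symm), Matrix.one_apply_eq] at this
    exact zero_ne_one this
  refine SemidirectProduct.ext (funext fun i => hρ ?_) hr
  ext s t
  have := hw' (i, s) (i, t)
  rw [hr, one_smul, if_pos rfl] at this
  rw [this]
  simp [Matrix.one_apply]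

theorem wreathMatrix_isometry {ρ : Q →* Matrix β β R} {σ : R →+* R}
    (hρ : ∀ x, ((ρ x).map σ)ᵀ * ρ x = 1) (w : PermWreath Q S Ω) :
    ((wreathMatrix ρ w).map σ)ᵀ * wreathMatrix ρ w = 1 := by
  ext ⟨i, s⟩ ⟨j, t⟩
  simp only [wreathMatrix, MonoidHom.coe_mk, OneHom.coe_mk, Matrix.mul_apply,
    Matrix.transpose_apply, Matrix.map_apply, Matrix.of_apply, Fintype.sum_prod_type]
  rw [Finset.sum_eq_single (w.right • i)]
  · by_cases h : i = j
    · subst h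
      have := congrFun (congrFun (hρ (w.left (w.right • i))) s) t
      simp only [Matrix.mul_apply, Matrix.transpose_apply, Matrix.map_apply] at this
      simpa [Matrix.one_apply] using this
    · simp [h]
  · intro k _ hk
    simp [hk]
  · simp

/-- The block monomial matrices of `wreathMatrix`, extended by an identity block on the indices in
`γ` and reindexed by `Fin n`, as elements of the general linear group. -/
def blockMonomial {n : ℕ} (e : (Ω × β) ⊕ γ ≃ Fin n) (ρ : Q →* Matrix β β R) :
    PermWreath Q S Ω →* GL (Fin n) R :=
  MonoidHom.toHomUnits
    { toFun := fun w => Matrix.reindex e e (Matrix.fromBlocks (wreathMatrix ρ w) 0 0 1)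
      map_one' := by
        rw [map_one, Matrix.fromBlocks_one]
        simp
      map_mul' := fun w w' => by
        simp [Matrix.fromBlocks_multiply, Matrix.submatrix_mul_equiv] }

theorem coe_blockMonomial {n : ℕ} (e : (Ω × β) ⊕ γ ≃ Fin n) (ρ : Q →* Matrix β β R)
    (w : PermWreath Q S Ω) : (blockMonomial e ρ w : Matrix (Fin n) (Fin n) R) =
      Matrix.reindex e e (Matrix.fromBlocks (wreathMatrix ρ w) 0 0 1) := rfl

theorem blockMonomial_injective {n : ℕ} (e : (Ω × β) ⊕ γ ≃ Fin n) {ρ : Q →* Matrix β β R}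
    (hρ : Function.Injective ρ) [Nontrivial R] [FaithfulSMul S Ω] [Nonempty β] :
    Function.Injective (blockMonomial (S := S) e ρ) := by
  intro w w' h
  have h1 := congrArg (Units.val) h
  rw [coe_blockMonomial, coe_blockMonomial] at h1
  exact wreathMatrix_injective hρ (Matrix.fromBlocks_inj.1 ((Matrix.reindex e e).injective h1)).1

theorem blockMonomial_mem_isometrySubgroup {n : ℕ} (e : (Ω × β) ⊕ γ ≃ Fin n)
    {ρ : Q →* Matrix β β R} {σ : R →+* R} (hρ : ∀ x, ((ρ x).map σ)ᵀ * ρ x = 1)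
    (w : PermWreath Q S Ω) : blockMonomial e ρ w ∈ isometrySubgroup n σ := by
  change ((blockMonomial e ρ w : Matrix (Fin n) (Fin n) R).map σ)ᵀ * _ = 1
  rw [coe_blockMonomial]
  simp [Matrix.fromBlocks_map, Matrix.fromBlocks_transpose, Matrix.fromBlocks_multiply,
    Matrix.submatrix_mul_equiv, wreathMatrix_isometry hρ, ← Matrix.submatrix_map]

end BlockMonomial

/-- Let `Q` be abelian of order `3 ^ a` with a faithful representation `ρ` of degree `b`. If the
block monomial matrices built from `ρ` and a Sylow `3`-subgroup of the symmetric group on `m` points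
lie in `H`, and if their number is the `3`-part of the order of `H`, then they form a Sylow
`3`-subgroup of `H`, whose abelianization is known. -/
theorem commutator_sylow_index_eq_nine_iff {R : Type*} [Field R] [Finite R] {n b m r a : ℕ}
    (hn : m * b + r = n) (hb : b ≠ 0) (ha : 1 ≤ a) {Q : Type*} [CommGroup Q]
    (hQ : Nat.card Q = 3 ^ a) {ρ : Q →* Matrix (Fin b) (Fin b) R} (hρ : Function.Injective ρ)
    {H : Subgroup (GL (Fin n) R)}
    (hH : ∀ (S : Sylow 3 (Equiv.Perm (Fin m))) (e : (Fin m × Fin b) ⊕ Fin r ≃ Fin n)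
      (w : PermWreath Q S (Fin m)), blockMonomial e ρ w ∈ H)
    (hcard : padicValNat 3 (Nat.card H) = a * m + padicValNat 3 m.factorial) (P : Sylow 3 H) :
    (commutator P).index = 9 ↔ (m = 1 ∧ a = 2) ∨ ((m = 2 ∨ m = 3) ∧ a = 1) := by
  have : Fact (Nat.Prime 3) := ⟨Nat.prime_three⟩
  have : NeZero b := ⟨hb⟩
  obtain ⟨S⟩ : Nonempty (Sylow 3 (Equiv.Perm (Fin m))) := inferInstance
  have e : (Fin m × Fin b) ⊕ Fin r ≃ Fin n := Fintype.equivFinOfCardEq (by simp [hn])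
  let φ : PermWreath Q S (Fin m) →* H := (blockMonomial e ρ).codRestrict H (hH S e)
  have hφ : Function.Injective φ := fun w w' h =>
    blockMonomial_injective e hρ (congrArg Subtype.val h)
  have hW : Nat.card φ.range = 3 ^ (Nat.card H).factorization 3 := by
    rw [← Nat.card_congr (MonoidHom.ofInjective hφ).toEquiv, card_permWreath, hQ,
      card_sylow_perm, Nat.factorization_def _ Nat.prime_three, hcard, Fintype.card_fin, pow_add,
      pow_mul]
  let E : P ≃* PermWreath Q S (Fin m) :=
    (P.equiv (Sylow.ofCard φ.range hW)).trans (MonoidHom.ofInjective hφ).symm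
  rw [commutator_index_congr E, commutator_permWreath_index, hQ,
    pow_mul_commutator_index_eq_nine_iff S ha]

/-! ### Cyclic `3`-subgroups in dimension one and two -/

theorem card_rootsOfUnity_of_dvd {K : Type*} [Field K] [Finite K] {k : ℕ}
    (hk : k ∣ Nat.card K - 1) : Nat.card (rootsOfUnity k K) = k := by
  rw [rootsOfUnity_eq_ker, IsCyclic.card_powMonoidHom_ker, Nat.card_units, Nat.gcd_eq_right hk]

/-- The `k`-th roots of unity as matrices of size one. -/
def rootsOfUnityScalar (F : Type*) [Field F] (k : ℕ) :
    rootsOfUnity k F →* Matrix (Fin 1) (Fin 1) F :=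
  ((Matrix.scalar (Fin 1)).toMonoidHom.comp (Units.coeHom F)).comp (rootsOfUnity k F).subtype

theorem rootsOfUnityScalar_injective (F : Type*) [Field F] (k : ℕ) :
    Function.Injective (rootsOfUnityScalar F k) := by
  intro x y h
  exact Subtype.ext (Units.ext (Matrix.scalar_inj.1 h))

theorem rootsOfUnityScalar_isometry {F : Type*} [Field F] {q k : ℕ} {σ : F →+* F}
    (hσ : ∀ x, σ x = x ^ q) (hk : k ∣ q + 1) (x : rootsOfUnity k F) :
    ((rootsOfUnityScalar F k x).map σ)ᵀ * rootsOfUnityScalar F k x = 1 := by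
  change ((Matrix.scalar (Fin 1) (x.1 : F)).map σ)ᵀ * Matrix.scalar (Fin 1) (x.1 : F) = 1
  have hx : (x.1 : F) ^ (q + 1) = 1 := by
    obtain ⟨j, hj⟩ := hk
    have := congrArg Units.val ((mem_rootsOfUnity k x.1).1 x.2)
    rw [hj, pow_mul, ← Units.val_pow_eq_pow_val, this, Units.val_one, one_pow]
  ext i j
  rw [Subsingleton.elim i 0, Subsingleton.elim j 0]
  simp [Matrix.mul_apply, hσ, ← pow_succ, hx]

/-- The multiplicative group of the quadratic extension of `𝔽_q` acts faithfully on that extension,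
a two-dimensional space over `𝔽_q`. -/
theorem exists_injective_rootsOfUnity_matrix_two {F : Type*} [Field F] [Finite F] {q k : ℕ}
    (hF : Nat.card F = q) (hk : k ∣ q + 1) :
    ∃ (Q : Type) (_ : CommGroup Q) (ρ : Q →* Matrix (Fin 2) (Fin 2) F),
      Nat.card Q = k ∧ Function.Injective ρ := by
  obtain ⟨p, hp⟩ := CharP.exists F
  have : Fact p.Prime := ⟨CharP.char_is_prime F p⟩
  let K := FiniteField.Extension F p 2
  have hK : Nat.card K = q ^ 2 := by rw [FiniteField.natCard_extension, hF]
  have hkK : k ∣ Nat.card K - 1 := by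
    rw [hK, ← one_pow 2, Nat.sq_sub_sq]
    exact hk.mul_right _
  let B : Module.Basis (Fin 2) F K :=
    Module.finBasisOfFinrankEq F K (FiniteField.finrank_extension F p 2)
  refine ⟨rootsOfUnity k K, inferInstance,
    ((Algebra.leftMulMatrix B : K →* Matrix (Fin 2) (Fin 2) F).comp (Units.coeHom K)).comp
      (rootsOfUnity k K).subtype, card_rootsOfUnity_of_dvd hkK, fun x y h => ?_⟩
  exact Subtype.ext (Units.ext (Algebra.leftMulMatrix_injective B h))

section Hyperbolic

variable {F : Type*} [Field F] {q : ℕ} {σ : F →+* F}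

theorem exists_map_mul_self_eq_neg_one [Finite F] (hF : Nat.card F = q ^ 2)
    (hσ : ∀ x, σ x = x ^ q) : ∃ b : F, σ b * b = -1 := by
  have h := card_pow_eq_of_pow_eq_self hF (s := -1) (by rw [← hσ, map_neg, map_one])
    (neg_ne_zero.2 one_ne_zero)
  have hpos : 0 < Nat.card {c : F // c ^ (q + 1) = -1} := by omega
  obtain ⟨⟨c, hc⟩⟩ := (Nat.card_pos_iff.1 hpos).1
  exact ⟨c, by rw [hσ, ← pow_succ, hc]⟩

theorem exists_add_map_eq_one [Finite F] (hF : Nat.card F = q ^ 2) (hσ : ∀ x, σ x = x ^ q) :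
    ∃ c : F, c + σ c = 1 := by
  have hσσ := map_map_of_card_eq_sq hF hσ
  obtain ⟨x, hx⟩ : ∃ x : F, x + σ x ≠ 0 := by
    -- otherwise `σ x = -x` for all `x`, so the characteristic is two and norms are squares
    by_contra! h
    have h2 : (2 : F) = 0 := by
      have := h 1
      rwa [map_one, one_add_one_eq_two] at this
    -- so `1` is the only element of norm `1`, although there are `q + 1` of them
    have hs : Subsingleton {c : F // c ^ (q + 1) = 1} := by
      refine subsingleton_of_forall_eq ⟨1, one_pow _⟩ fun c => Subtype.ext ?_
      have hc := c.2
      rw [pow_succ, ← hσ, eq_neg_of_add_eq_zero_right (h c.1)] at hc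
      have : (c.1 - 1) ^ 2 = 0 := by linear_combination -hc - c.1 * h2
      exact sub_eq_zero.1 (pow_eq_zero_iff two_ne_zero |>.1 this)
    have h1 := card_pow_eq_of_pow_eq_self hF (s := 1) (one_pow _) one_ne_zero
    have := two_le_of_card_eq_sq hF
    have := Finite.card_le_one_iff_subsingleton.2 hs
    omega
  refine ⟨x / (x + σ x), ?_⟩
  rw [map_div₀, map_add, hσσ, add_comm (σ x) x, ← add_div, div_self hx]

/-- The standard Hermitian plane has a basis with Gram matrix `!![0, 1; 1, 0]`: take `(1, b)` with
`b` of norm `-1`, which is isotropic, and `(1, 0) - c • (1, b)` with `c` of trace `1`. -/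
theorem exists_hyperbolic_basis [Finite F] (hF : Nat.card F = q ^ 2) (hσ : ∀ x, σ x = x ^ q) :
    ∃ T : Matrix (Fin 2) (Fin 2) F, (T.map σ)ᵀ * T = !![0, 1; 1, 0] := by
  obtain ⟨b, hb⟩ := exists_map_mul_self_eq_neg_one hF hσ
  obtain ⟨c, hc⟩ := exists_add_map_eq_one hF hσ
  refine ⟨!![1, 1 - c; b, -(c * b)], ?_⟩
  ext i j
  fin_cases i <;> fin_cases j <;> simp [Matrix.mul_apply, Fin.sum_univ_two]
  · linear_combination hb
  · linear_combination -c * hb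
  · linear_combination -(σ c) * hb
  · linear_combination (c * σ c) * hb - hc

/-- For `ζ` in `𝔽_q`, the matrix `diag(ζ, ζ⁻¹)` with respect to a hyperbolic basis is unitary. -/
theorem exists_injective_rootsOfUnity_isometry_two [Finite F] (hF : Nat.card F = q ^ 2)
    (hσ : ∀ x, σ x = x ^ q) {k : ℕ} (hk : k ∣ q - 1) :
    ∃ ρ : rootsOfUnity k F →* Matrix (Fin 2) (Fin 2) F,
      Function.Injective ρ ∧ ∀ x, ((ρ x).map σ)ᵀ * ρ x = 1 := by
  have hσσ := map_map_of_card_eq_sq hF hσ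
  obtain ⟨T, hT⟩ := exists_hyperbolic_basis hF hσ
  set J : Matrix (Fin 2) (Fin 2) F := !![0, 1; 1, 0] with hJ
  have hJJ : J * J = 1 := by
    rw [hJ]
    ext i j
    fin_cases i <;> fin_cases j <;> simp
  have hJσ : (J.map σ)ᵀ = J := by
    rw [hJ]
    ext i j
    fin_cases i <;> fin_cases j <;> simp
  set T' := J * (T.map σ)ᵀ with hT'
  have hT'T : T' * T = 1 := by rw [hT', Matrix.mul_assoc, hT, hJJ]
  have hTT' : T * T' = 1 := mul_eq_one_comm.1 hT'T
  let D : rootsOfUnity k F → Matrix (Fin 2) (Fin 2) F :=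
    fun x => Matrix.diagonal ![(x.1 : F), ((x.1⁻¹ : Fˣ) : F)]
  have hDσ : ∀ x, ((D x).map σ)ᵀ = D x := by
    intro x
    have hx : x.1 ^ (q - 1) = 1 := by
      obtain ⟨j, hj⟩ := hk
      rw [hj, pow_mul, (mem_rootsOfUnity k x.1).1 x.2, one_pow]
    have hq := two_le_of_card_eq_sq hF
    have hxq : x.1 ^ q = x.1 := by
      rw [← Nat.sub_add_cancel (show 1 ≤ q by omega), pow_succ, hx, one_mul]
    have h1 : σ (x.1 : F) = x.1 := by rw [hσ, ← Units.val_pow_eq_pow_val, hxq]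
    have h2 : σ ((x.1⁻¹ : Fˣ) : F) = (x.1⁻¹ : Fˣ) := by
      rw [hσ, ← Units.val_pow_eq_pow_val, inv_pow, hxq]
    ext i j
    fin_cases i <;> fin_cases j <;> simp [D, h1]
  have hJDJD : ∀ x, J * D x * J * D x = 1 := by
    intro x
    have hJD : J * D x = !![0, ((x.1⁻¹ : Fˣ) : F); (x.1 : F), 0] := by
      ext i j
      fin_cases i <;> fin_cases j <;> simp [D, hJ]
    rw [Matrix.mul_assoc, hJD]
    ext i j
    fin_cases i <;> fin_cases j <;> simp
  refine ⟨{ toFun := fun x => T * D x * T', map_one' := ?_, map_mul' := ?_ }, ?_, ?_⟩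
  · have : D 1 = 1 := by
      ext i j
      fin_cases i <;> fin_cases j <;> simp [D]
    rw [this, Matrix.mul_one, hTT']
  · intro x y
    have hxy : D (x * y) = D x * D y := by
      ext i j
      fin_cases i <;> fin_cases j <;> simp [D, mul_comm]
    calc T * D (x * y) * T' = T * D x * 1 * D y * T' := by
          rw [hxy]; simp only [Matrix.mul_assoc, Matrix.mul_one]
      _ = T * D x * T' * (T * D y * T') := by rw [← hT'T]; simp only [Matrix.mul_assoc]
  · intro x y hxy
    have hD : D x = D y := by
      have hconj : ∀ z, D z = T' * (T * D z * T') * T := fun z => by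
        rw [Matrix.mul_assoc, Matrix.mul_assoc _ T' T, hT'T, Matrix.mul_one, ← Matrix.mul_assoc,
          hT'T, Matrix.one_mul]
      rw [hconj x, hconj y]
      exact congrArg (fun M => T' * M * T) hxy
    have := congrFun (congrFun hD 0) 0
    exact Subtype.ext (Units.ext (by simpa [D] using this))
  · intro x
    have hT'σ : (T'.map σ)ᵀ = T * J := by
      rw [hT', Matrix.map_mul, Matrix.transpose_mul, hJσ]
      congr 1
      ext i j
      simp [hσσ]
    change ((T * D x * T').map σ)ᵀ * (T * D x * T') = 1
    rw [Matrix.map_mul, Matrix.map_mul, Matrix.transpose_mul, Matrix.transpose_mul, hT'σ, hDσ]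
    calc T * J * (D x * (T.map σ)ᵀ) * (T * D x * T')
        = T * J * D x * ((T.map σ)ᵀ * T) * D x * T' := by simp only [Matrix.mul_assoc]
      _ = T * (J * D x * J * D x) * T' := by rw [hT]; simp only [Matrix.mul_assoc]
      _ = 1 := by rw [hJDJD, Matrix.mul_one, hTT']

end Hyperbolic

/-! ### Index of the commutator subgroup of a Sylow 3-subgroup -/

theorem padicValNat_natCast_eq {k : ℕ} {z : ℤ} (h : (k : ℤ) = z) :
    padicValNat 3 k = padicValInt 3 z := by
  rw [← h, padicValInt.of_nat]

theorem threePart_eq_pow_iff {z : ℤ} {k : ℕ} : threePart z = 3 ^ k ↔ padicValInt 3 z = k :=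
  Nat.pow_right_inj (by norm_num)

theorem one_le_padicValInt {z : ℤ} (hz : z ≠ 0) (h : (3 : ℤ) ∣ z) : 1 ≤ padicValInt 3 z := by
  have : Fact (Nat.Prime 3) := ⟨Nat.prime_three⟩
  exact ((padicValInt_dvd_iff (p := 3) 1 z).1 (by simpa using h)).resolve_left hz

theorem pow_padicValInt_dvd {z : ℤ} {k : ℕ} (h : (k : ℤ) = z) : 3 ^ padicValInt 3 z ∣ k := by
  rw [← h, padicValInt.of_nat]
  exact pow_padicValNat_dvd

/-- The case `ε = 1`. The group `H` is a variable, known to be the full group only through an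
equation, so that the type of `P` need not be rewritten when `H` is `GLEps n p f 1`. -/
theorem commutator_sylow_linear_index_eq_nine_iff {F : Type*} [Field F] [Finite F] {q n : ℕ}
    (hF : Nat.card F = q)
    (H : Subgroup (GL (Fin n) F)) (hH : H = ⊤) (P : Sylow 3 H) :
    ((3 : ℤ) ∣ (q : ℤ) - 1 → ((commutator P).index = 9 ↔
      (n = 1 ∧ padicValInt 3 (q - 1) = 2) ∨
        ((n = 2 ∨ n = 3) ∧ padicValInt 3 (q - 1) = 1))) ∧
    ((3 : ℤ) ∣ (q : ℤ) + 1 → ((commutator P).index = 9 ↔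
      (n / 2 = 1 ∧ padicValInt 3 (q + 1) = 2) ∨
        ((n / 2 = 2 ∨ n / 2 = 3) ∧ padicValInt 3 (q + 1) = 1))) := by
  have hq : 2 ≤ q := hF ▸ Finite.one_lt_card
  have hcard : padicValNat 3 (Nat.card H) = padicValInt 3
      (∏ d ∈ Finset.range n, (q : ℤ) ^ d * ((q : ℤ) ^ (d + 1) - ((1 : ℤˣ) : ℤ) ^ (d + 1))) := by
    refine padicValNat_natCast_eq ?_
    rw [hH, Subgroup.card_top, card_GL_eq_prod hF]
    simp
  constructor
  · intro h3
    have h3' : (3 : ℤ) ∣ q - ((1 : ℤˣ) : ℤ) := by simpa using h3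
    refine commutator_sylow_index_eq_nine_iff (m := n) (b := 1) (r := 0) (by omega) one_ne_zero
      (one_le_padicValInt (by omega) h3)
      (card_rootsOfUnity_of_dvd (pow_padicValInt_dvd ?_)) (rootsOfUnityScalar_injective F _)
      (fun _ _ _ => hH ▸ Subgroup.mem_top _) ?_ P
    · rw [hF]
      push_cast [show 1 ≤ q by omega]
      rfl
    · rw [hcard, padicValInt_prod_of_three_dvd_sub hq 1 h3']
      simp
  · intro h3
    have h3' : (3 : ℤ) ∣ q + ((1 : ℤˣ) : ℤ) := by simpa using h3
    obtain ⟨Q, _, ρ, hQ, hρ⟩ := exists_injective_rootsOfUnity_matrix_two hF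
      (pow_padicValInt_dvd (z := q + 1) (k := q + 1) (by push_cast; rfl))
    refine commutator_sylow_index_eq_nine_iff (m := n / 2) (b := 2) (r := n % 2) (by omega)
      two_ne_zero (one_le_padicValInt (by omega) h3) hQ hρ
      (fun _ _ _ => hH ▸ Subgroup.mem_top _) ?_ P
    rw [hcard, padicValInt_prod_of_three_dvd_add hq 1 h3']
    simp

/-- The case `ε = -1`, with `H` a variable as in `commutator_sylow_linear_index_eq_nine_iff`. -/
theorem commutator_sylow_unitary_index_eq_nine_iff {F : Type*} [Field F] [Finite F] {q n : ℕ}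
    (hF : Nat.card F = q ^ 2) {σ : F →+* F} (hσ : ∀ x, σ x = x ^ q)
    (H : Subgroup (GL (Fin n) F)) (hH : H = isometrySubgroup n σ) (P : Sylow 3 H) :
    ((3 : ℤ) ∣ (q : ℤ) + 1 → ((commutator P).index = 9 ↔
      (n = 1 ∧ padicValInt 3 (q + 1) = 2) ∨
        ((n = 2 ∨ n = 3) ∧ padicValInt 3 (q + 1) = 1))) ∧
    ((3 : ℤ) ∣ (q : ℤ) - 1 → ((commutator P).index = 9 ↔
      (n / 2 = 1 ∧ padicValInt 3 (q - 1) = 2) ∨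
        ((n / 2 = 2 ∨ n / 2 = 3) ∧ padicValInt 3 (q - 1) = 1))) := by
  have hq : 2 ≤ q := two_le_of_card_eq_sq hF
  have hcard : padicValNat 3 (Nat.card H) = padicValInt 3
      (∏ d ∈ Finset.range n, (q : ℤ) ^ d * ((q : ℤ) ^ (d + 1) - ((-1 : ℤˣ) : ℤ) ^ (d + 1))) := by
    refine padicValNat_natCast_eq ?_
    rw [hH, card_isometrySubgroup hF hσ]
    simp
  have hF1 : Nat.card F - 1 = (q + 1) * (q - 1) := by rw [hF, ← one_pow 2, Nat.sq_sub_sq, one_pow]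
  constructor
  · intro h3
    have h3' : (3 : ℤ) ∣ q - ((-1 : ℤˣ) : ℤ) := by simpa using h3
    have hdvd : 3 ^ padicValInt 3 (q + 1) ∣ q + 1 := pow_padicValInt_dvd (by push_cast; rfl)
    refine commutator_sylow_index_eq_nine_iff (m := n) (b := 1) (r := 0) (by omega) one_ne_zero
      (one_le_padicValInt (by omega) h3)
      (card_rootsOfUnity_of_dvd (hF1 ▸ hdvd.mul_right _)) (rootsOfUnityScalar_injective F _)
      (fun _ e w => hH ▸ blockMonomial_mem_isometrySubgroup e
        (rootsOfUnityScalar_isometry hσ hdvd) w) ?_ P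
    rw [hcard, padicValInt_prod_of_three_dvd_sub hq (-1) h3']
    simp
  · intro h3
    have h3' : (3 : ℤ) ∣ q + ((-1 : ℤˣ) : ℤ) := by simpa [← sub_eq_add_neg] using h3
    have hdvd : 3 ^ padicValInt 3 (q - 1) ∣ q - 1 :=
      pow_padicValInt_dvd (by push_cast [show 1 ≤ q by omega]; rfl)
    obtain ⟨ρ, hρ, hiso⟩ := exists_injective_rootsOfUnity_isometry_two hF hσ hdvd
    refine commutator_sylow_index_eq_nine_iff (m := n / 2) (b := 2) (r := n % 2) (by omega)
      two_ne_zero (one_le_padicValInt (by omega) h3)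
      (card_rootsOfUnity_of_dvd (hF1 ▸ hdvd.mul_left _)) hρ
      (fun _ e w => hH ▸ blockMonomial_mem_isometrySubgroup e hiso w) ?_ P
    rw [hcard, padicValInt_prod_of_three_dvd_add hq (-1) h3']
    simp [sub_eq_add_neg]

theorem proposition5p12 (p f n : ℕ) [Fact p.Prime] (hf : 1 ≤ f) (hn : 1 ≤ n) (ε : ℤˣ)
    (q : ℕ) (hq : q = p ^ f) (P : Sylow 3 (GLEps n p f ε)) :
    ((3 : ℤ) ∣ (q : ℤ) - (ε : ℤ) →
      ((commutator P).index = 9 ↔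
        (n = 1 ∧ threePart ((q : ℤ) - (ε : ℤ)) = 9) ∨
        ((n = 2 ∨ n = 3) ∧ threePart ((q : ℤ) - (ε : ℤ)) = 3))) ∧
    ((3 : ℤ) ∣ (q : ℤ) + (ε : ℤ) →
      ((commutator P).index = 9 ↔
        ((n = 2 ∨ n = 3) ∧ threePart ((q : ℤ) + (ε : ℤ)) = 9) ∨
        (4 ≤ n ∧ n ≤ 7 ∧ threePart ((q : ℤ) + (ε : ℤ)) = 3))) := by
  have h9 : ∀ z : ℤ, threePart z = 9 ↔ padicValInt 3 z = 2 := fun z => threePart_eq_pow_iff (k := 2)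
  have h3 : ∀ z : ℤ, threePart z = 3 ↔ padicValInt 3 z = 1 := fun z => threePart_eq_pow_iff (k := 1)
  simp only [h9, h3]
  rcases Int.units_eq_one_or ε with rfl | rfl
  · have hF : Nat.card (GLEpsField p f 1) = q := by
      rw [GLEpsField, if_pos rfl, GaloisField.card p f (by omega), hq]
    obtain ⟨h1, h2⟩ := commutator_sylow_linear_index_eq_nine_iff hF (GLEps n p f 1) (if_pos rfl) P
    refine ⟨by simpa using h1, fun h => ?_⟩
    rw [Units.val_one] at h ⊢
    rw [h2 h]
    omega
  · have hne : (-1 : ℤˣ) ≠ 1 := by decide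
    have hF : Nat.card (GLEpsField p f (-1)) = q ^ 2 := by
      rw [GLEpsField, if_neg hne, GaloisField.card p _ (by omega), hq, ← pow_mul, mul_comm]
    obtain ⟨h1, h2⟩ := commutator_sylow_unitary_index_eq_nine_iff hF
      (σ := iterateFrobenius (GLEpsField p f (-1)) p f)
      (fun x => by rw [iterateFrobenius_def, hq]) (GLEps n p f (-1)) (if_neg hne) P
    refine ⟨by simpa using h1, fun h => ?_⟩
    have he : (q : ℤ) + ((-1 : ℤˣ) : ℤ) = q - 1 := by simp [sub_eq_add_neg]
    rw [he] at h ⊢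
    rw [h2 h]
    omega
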